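/- Let $\mathcal H$ be the hypergraph with the twelve vertices $a,b,c,d,v_a,v_b,v_d,u_b,u_c,u_d,t,t'$ whose hyperedges are the following sixteen sets of size two, $$\{a,b\},\{a,c\},\{a,d\},\{b,c\},\{b,d\},\{c,d\},\ \{a,v_a\},\{v_a,v_d\},\{v_d,v_b\},\{v_b,b\},\{d,v_d\},\ \{b,u_b\},\{u_b,u_d\},\{u_d,u_c\},\{u_c,c\},\{d,u_d\},$$ and the following eight sets of size five: $$\{a,v_a,t,t',c\},\{a,v_b,t,t',c\},\{b,v_a,t,t',c\},\{b,v_b,t,t',c\},\{b,u_b,t,t',a\},\{b,u_c,t,t',a\},\{c,u_b,t,t',a\},\{c,u_c,t,t',a\}.$$ A support for a hypergraph is a graph on the same vertex set in which every hyperedge induces a connected subgraph. A graph is $r$-outerplanar if it has an embedding into the plane such that removing $r$ times all vertices on the outer face leaves the empty graph. Two vertices are twins if they lie in exactly the same hyperedges. For a vertex $v$, the hypergraph $\mathcal H-v$ is obtained by removing $v$ from the vertex set and from every hyperedge, and then dropping hyperedges that are empty or singletons. Then $t$ and $t'$ are (distinct) twins of $\mathcal H$. The graph whose edges are the sixteen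 pairs above together with $at,\ bt,\ v_at,\ v_bt,\ ct',\ bt',\ u_bt',\ u_ct'$ is a $2$-outerplanar support for $\mathcal H$; in particular, $\mathcal H$ has a $2$-outerplanar support. Neither $\mathcal H-t$ nor $\mathcal H-t'$ has a planar support. Consequently, removing one of two twins can turn a yes-instance into a no-instance of the problem that asks, for a connected hypergraph and a number $r$, whether the hypergraph has an $r$-outerplanar support: $\mathcal H$, $\mathcal H-t$ and $\mathcal H-t'$ are connected and, for every $r\ge 2$, $(\mathcal H,r)$ is a yes-instance while $(\mathcal H-t,r)$ and $(\mathcal H-t',r)$ are no-instances. -/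

import Mathlib

/-- The Euclidean plane. -/
abbrev Plane : Type := EuclideanSpace ℝ (Fin 2)

/-- `A` is an arc in the plane linking `p` and `q`: the image of an injective path from `p` to `q`
(an injective continuous map on `[0,1]` is a homeomorphism onto its image). -/
def IsArcBetween (A : Set Plane) (p q : Plane) : Prop :=
  ∃ γ : Path p q, Function.Injective γ ∧ Set.range γ = A

/-- An embedding of a graph into the plane: distinct points for the vertices, an arc for each edge
linking the points of its two ends, such that the interior of an arc contains no vertex point and no
point of another arc. (The values of `arc` at non-edges play no role.) -/
structure PlaneEmbedding {V : Type*} (G : SimpleGraph V) where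
  /-- the point of a vertex -/
  point : V → Plane
  /-- the arc of an edge -/
  arc : Sym2 V → Set Plane
  point_injective : Function.Injective point
  isArc : ∀ u v, G.Adj u v → IsArcBetween (arc s(u, v)) (point u) (point v)
  mem_of_point_mem_arc : ∀ e ∈ G.edgeSet, ∀ w, point w ∈ arc e → w ∈ e
  endpoint_of_mem_arcs : ∀ e ∈ G.edgeSet, ∀ f ∈ G.edgeSet, e ≠ f →
    ∀ x, x ∈ arc e → x ∈ arc f → ∃ w ∈ e, x = point w

namespace PlaneEmbedding

variable {V : Type*} {G : SimpleGraph V}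

/-- The point set of the plane graph that remains after removing the vertices in `S` (together with
all edges incident with them). -/
def drawing (E : PlaneEmbedding G) (S : Set V) : Set Plane :=
  E.point '' Sᶜ ∪ ⋃ e ∈ {e ∈ G.edgeSet | ∀ v ∈ e, v ∉ S}, E.arc e

/-- `F` is a face of the plane graph that remains after removing `S`: a region (that is, a class of
points linked by paths) of the complement of its point set. -/
def IsFace (E : PlaneEmbedding G) (S : Set V) (F : Set Plane) : Prop :=
  ∃ x ∈ (E.drawing S)ᶜ, F = pathComponentIn (E.drawing S)ᶜ x

/-- The vertices on the outer (unbounded) face of the plane graph that remains after removing the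
vertices in `S`. -/
def outerVertices (E : PlaneEmbedding G) (S : Set V) : Set V :=
  {v | v ∉ S ∧ ∃ F, E.IsFace S F ∧ ¬ Bornology.IsBounded F ∧ E.point v ∈ closure F}

/-- The vertices removed after `i` rounds, each of which removes all vertices on the outer face of
what is left; that is, the union of the first `i` layers. -/
def removed (E : PlaneEmbedding G) : ℕ → Set V
  | 0 => ∅
  | i + 1 => E.removed i ∪ E.outerVertices (E.removed i)

end PlaneEmbedding

namespace SimpleGraph

variable {V : Type*}

/-- A graph is planar if it has an embedding into the plane. -/
def IsPlanar (G : SimpleGraph V) : Prop := Nonempty (PlaneEmbedding G)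

/-- A graph is `r`-outerplanar if it has an embedding into the plane such that removing `r` times
all vertices on the outer face leaves the empty graph. -/
def IsROuterplanar (G : SimpleGraph V) (r : ℕ) : Prop :=
  ∃ E : PlaneEmbedding G, E.removed r = Set.univ

end SimpleGraph

namespace Hypergraph

variable {α : Type*}

/-- Two vertices are twins if they are contained in precisely the same hyperedges. -/
def AreTwins (H : Hypergraph α) (u v : α) : Prop :=
  u ∈ H.vertexSet ∧ v ∈ H.vertexSet ∧ {F ∈ H.edgeSet | u ∈ F} = {F ∈ H.edgeSet | v ∈ F}

/-- The hypergraph `H - S`: the vertices in `S` are removed from the vertex set and from every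
hyperedge, and the hyperedges that become empty or singletons are dropped. -/
def removeVertices (H : Hypergraph α) (S : Set α) : Hypergraph α where
  vertexSet := H.vertexSet \ S
  edgeSet := {F' | (∃ F ∈ H.edgeSet, F' = F \ S) ∧ F'.Nontrivial}
  subset_vertexSet_of_mem_edgeSet' := by
    rintro _ ⟨⟨F, hF, rfl⟩, -⟩
    exact Set.sdiff_subset_sdiff_left (H.subset_vertexSet_of_mem_edgeSet' hF)

/-- Any two vertices are linked by a sequence of vertices in which consecutive ones share a
hyperedge. -/
def IsConnected (H : Hypergraph α) : Prop :=
  H.vertexSet.Nonempty ∧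
    ∀ u ∈ H.vertexSet, ∀ v ∈ H.vertexSet, Relation.ReflTransGen H.Adj u v

/-- A support for `H` is a graph on the vertex set of `H` in which every hyperedge induces a
connected subgraph. -/
def IsSupport (H : Hypergraph α) (G : SimpleGraph H.vertexSet) : Prop :=
  ∀ F ∈ H.edgeSet, (G.induce {v : H.vertexSet | (v : α) ∈ F}).Connected

/-- `H` has a planar support. -/
def HasPlanarSupport (H : Hypergraph α) : Prop :=
  ∃ G : SimpleGraph H.vertexSet, H.IsSupport G ∧ G.IsPlanar

/-- `H` has an `r`-outerplanar support. -/
def HasROuterplanarSupport (H : Hypergraph α) (r : ℕ) : Prop :=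
  ∃ G : SimpleGraph H.vertexSet, H.IsSupport G ∧ G.IsROuterplanar r

/-- `(H, r)` is a yes-instance of the problem that asks, for a connected hypergraph `H` and a number
`r`, whether `H` has an `r`-outerplanar support. -/
def IsYesInstance (H : Hypergraph α) (r : ℕ) : Prop :=
  H.IsConnected ∧ H.HasROuterplanarSupport r

/-- `(H, r)` is a no-instance of that problem. -/
def IsNoInstance (H : Hypergraph α) (r : ℕ) : Prop :=
  H.IsConnected ∧ ¬ H.HasROuterplanarSupport r

end Hypergraph

namespace TwinExample

/-- The twelve vertices `a, b, c, d, v_a, v_b, v_d, u_b, u_c, u_d, t, t'`. -/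
inductive Vert : Type
  | a | b | c | d | va | vb | vd | ub | uc | ud | t | t'
  deriving DecidableEq

open Vert

/-- The solid edges: a `K₄` on `a, b, c, d`, and the `v`- and `u`-vertices attached to it. -/
def solidEdges : Set (Sym2 Vert) :=
  {s(a, b), s(a, c), s(a, d), s(b, c), s(b, d), s(c, d),
   s(a, va), s(va, vd), s(vd, vb), s(vb, b), s(d, vd),
   s(b, ub), s(ub, ud), s(ud, uc), s(uc, c), s(d, ud)}

/-- The dotted edges, incident with `t` and `t'`. -/
def dottedEdges : Set (Sym2 Vert) :=
  {s(a, t), s(b, t), s(va, t), s(vb, t), s(c, t'), s(b, t'), s(ub, t'), s(uc, t')}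

/-- The hyperedges of size five. -/
def largeHyperedges : Set (Set Vert) :=
  {{a, va, t, t', c}, {a, vb, t, t', c}, {b, va, t, t', c}, {b, vb, t, t', c},
   {b, ub, t, t', a}, {b, uc, t, t', a}, {c, ub, t, t', a}, {c, uc, t, t', a}}

/-- The hypergraph: its hyperedges are the solid edges, as two-element sets, and the large
hyperedges. -/
def H : Hypergraph Vert where
  vertexSet := Set.univ
  edgeSet := {F | ∃ x y, s(x, y) ∈ solidEdges ∧ F = {x, y}} ∪ largeHyperedges
  subset_vertexSet_of_mem_edgeSet' := fun _ _ => Set.subset_univ _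

/-- The graph formed by the solid and the dotted edges, on the vertex set of `H`. -/
def drawnGraph : SimpleGraph H.vertexSet :=
  (SimpleGraph.fromEdgeSet (solidEdges ∪ dottedEdges)).induce H.vertexSet

end TwinExample

/-! Non-planarity. Once one twin is removed, a support still contains all solid edges, and four of
the large hyperedges force a further neighbour on each of `vb`, `va`, `uc`, `ub`. In a planar graph
`c` cannot reach `va` or `vb` while avoiding the rest of `a`, `b`, `d` and the `v`-path, and `vb a`,
`va b` cannot both be edges; so the remaining twin is adjacent to `va` or `vb`. Likewise it is
adjacent to `ub` or `uc`, so it connects `c` to the `v`-path through the `u`-path. Each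
contradiction is a subdivision of `K₃,₃` (`false_of_hasDisjointRegions`). With both twins present,
`t` serves the `v`-path and `t'` the `u`-path.

That `K₃,₃` is not planar is proved by winding numbers (`Path.exists_inter_of_three_three`). For
disjoint paths `γ`, `δ`, the function `γ s - δ t` has a logarithm on the square, so its increments
along the four sides cancel. This is one integer equation per pair of disjoint edges; the sum of all
eighteen fails modulo 2.

The positive part is a straight-line drawing with integer coordinates. Finitely many sign checks
show that edges do not cross and that rays to infinity expose `a`, `b`, `c`, and then every other
vertex. -/

open unitInterval

/-! ### Winding numbers and the non-planarity of `K₃,₃` -/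

/-- Two continuous logarithms of the same function, up to a constant factor, differ by a constant. -/
theorem Complex.sub_eq_sub_of_exp_eq_mul {X : Type*} [TopologicalSpace X] [PreconnectedSpace X]
    {f g : X → ℂ} (hf : Continuous f) (hg : Continuous g) (c : ℂ)
    (h : ∀ x, Complex.exp (f x) = c * Complex.exp (g x)) (x y : X) :
    f x - f y = g x - g y := by
  have key : ∀ z, Complex.exp (f z - g z) = c := fun z => by
    rw [Complex.exp_sub, h, mul_div_cancel_right₀ _ (Complex.exp_ne_zero _)]
  -- `f - g` and a constant map are both lifts of the constant map `c` through the covering `exp`.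
  have : f x - g x = f y - g y := by
    refine congrFun (Complex.isCoveringMap_exp.eq_of_comp_eq (g₁ := fun z => f z - g z)
      (g₂ := fun _ => f y - g y) (hf.sub hg) continuous_const ?_ y rfl) x
    ext z
    simp [key]
  linear_combination this

/-- A nowhere vanishing continuous function on the square has a continuous logarithm. -/
theorem Complex.exists_continuous_log_square (F : C(I × I, ℂ)) (h : ∀ x, F x ≠ 0) :
    ∃ L : C(I × I, ℂ), ∀ x, Complex.exp (L x) = F x := by
  have := (convex_Icc (0 : ℝ) 1).contractibleSpace ⟨0, by simp⟩
  have := (convex_Icc (0 : ℝ) 1).locallyPathConnectedSpace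
  obtain ⟨L, ⟨-, hL⟩, -⟩ := Complex.isCoveringMapOn_exp.existsUnique_continuousMap_lifts
    (f := F) (a₀ := (0, 0)) (e₀ := Complex.log (F (0, 0))) (by simp [Complex.exp_log, h])
    (by intro x; simpa using h x)
  exact ⟨L, fun x => congrFun hL x⟩

/-- The difference of two disjoint paths has a continuous logarithm on the square. -/
theorem Path.exists_log_sub {u v w z : ℂ} (γ : Path u v) (δ : Path w z)
    (h : ∀ s t, γ s ≠ δ t) :
    ∃ L : C(I × I, ℂ), ∀ s t, Complex.exp (L (s, t)) = γ s - δ t := by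
  obtain ⟨L, hL⟩ := Complex.exists_continuous_log_square
    ⟨fun x => γ x.1 - δ x.2, by fun_prop⟩ (fun x => by simpa [sub_eq_zero] using h x.1 x.2)
  exact ⟨L, fun s t => hL (s, t)⟩

/-- `n` counts the turns of the path `γ` around `w`, relative to the principal logarithms of the
directions from `w` to the ends of `γ`. -/
def Path.IsTurns {u v : ℂ} (γ : Path u v) (w : ℂ) (n : ℤ) : Prop :=
  ∀ ℓ : I → ℂ, Continuous ℓ → ∀ c : ℂ, c ≠ 0 → (∀ s, Complex.exp (ℓ s) = c * (γ s - w)) →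
    ℓ 1 - ℓ 0 = Complex.log (v - w) - Complex.log (u - w) + n * (2 * Real.pi * Complex.I)

/-- The increment of one logarithm of `γ - w` is a logarithm of `(v - w) / (u - w)`; any other
logarithm, even of a multiple `c * (γ - w)`, has the same increment. -/
theorem Path.exists_isTurns {u v w : ℂ} (γ : Path u v) (h : ∀ s, γ s ≠ w) :
    ∃ n : ℤ, γ.IsTurns w n := by
  obtain ⟨L, hL⟩ := γ.exists_log_sub (Path.refl w) (by simpa using h)
  have hv : v - w ≠ 0 := sub_ne_zero.2 (by simpa using h 1)
  have hu : u - w ≠ 0 := sub_ne_zero.2 (by simpa using h 0)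
  have he : Complex.exp (L (1, 0) - L (0, 0)) =
      Complex.exp (Complex.log (v - w) - Complex.log (u - w)) := by
    rw [Complex.exp_sub, Complex.exp_sub, hL, hL, Complex.exp_log hv, Complex.exp_log hu]
    simp
  obtain ⟨n, hn⟩ := Complex.exp_eq_exp_iff_exists_int.1 he
  refine ⟨n, fun ℓ hℓ c hc hℓc => ?_⟩
  rw [← hn]
  refine Complex.sub_eq_sub_of_exp_eq_mul (g := fun s => L (s, 0)) hℓ (by fun_prop) c
    (fun s => ?_) 1 0
  rw [hℓc, hL]
  simp

/-- The two differences are negatives of each other. The odd multiple of `π i` is the source of the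
parity contradiction for `K₃,₃`. -/
theorem Complex.exists_log_sub_comm {x y : ℂ} (h : x ≠ y) :
    ∃ k : ℤ, Complex.log (x - y) - Complex.log (y - x) = (2 * k + 1) * (Real.pi * Complex.I) := by
  have h1 : x - y ≠ 0 := sub_ne_zero.2 h
  have h2 : y - x ≠ 0 := sub_ne_zero.2 h.symm
  have he : Complex.exp (Complex.log (x - y)) =
      Complex.exp (Complex.log (y - x) + Real.pi * Complex.I) := by
    rw [Complex.exp_add, Complex.exp_log h1, Complex.exp_log h2, Complex.exp_pi_mul_I]
    ring
  obtain ⟨n, hn⟩ := Complex.exp_eq_exp_iff_exists_int.1 he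
  exact ⟨n, by rw [hn]; ring⟩

/-- The integer relation between the turns of two disjoint paths around each other's ends. -/
theorem Path.turns_relation {u v w z : ℂ} (γ : Path u v) (δ : Path w z) (h : ∀ s t, γ s ≠ δ t)
    {nw nz mu mv : ℤ} (hnw : γ.IsTurns w nw) (hnz : γ.IsTurns z nz)
    (hmu : δ.IsTurns u mu) (hmv : δ.IsTurns v mv) {kwu kzv kvw kuz : ℤ}
    (hwu : Complex.log (w - u) - Complex.log (u - w) = (2 * kwu + 1) * (Real.pi * Complex.I))
    (hzv : Complex.log (z - v) - Complex.log (v - z) = (2 * kzv + 1) * (Real.pi * Complex.I))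
    (hvw : Complex.log (v - w) - Complex.log (w - v) = (2 * kvw + 1) * (Real.pi * Complex.I))
    (huz : Complex.log (u - z) - Complex.log (z - u) = (2 * kuz + 1) * (Real.pi * Complex.I)) :
    kwu + kzv + kvw + kuz + 2 + nw + mv - nz - mu = 0 := by
  obtain ⟨L, hL⟩ := γ.exists_log_sub δ h
  have e1 := hnw (fun s => L (s, 0)) (by fun_prop) 1 one_ne_zero (by simp [hL])
  have e2 := hnz (fun s => L (s, 1)) (by fun_prop) 1 one_ne_zero (by simp [hL])
  -- On the sides `s = 0` and `s = 1` the function is `u - δ` and `v - δ`, hence the factor `-1`.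
  have e3 := hmu (fun s => L (0, s)) (by fun_prop) (-1) (by simp) (by simp [hL])
  have e4 := hmv (fun s => L (1, s)) (by fun_prop) (-1) (by simp) (by simp [hL])
  have hpi : (2 * Real.pi * Complex.I : ℂ) ≠ 0 := Complex.two_pi_I_ne_zero
  have : ((kwu + kzv + kvw + kuz + 2 + nw + mv - nz - mu : ℤ) : ℂ) * (2 * Real.pi * Complex.I) = 0 := by
    push_cast
    linear_combination e2 + e3 - e1 - e4 - hwu - hzv - hvw - huz
  exact_mod_cast (mul_eq_zero.1 this).resolve_right hpi

/-- `K₃,₃` is not planar, in the form that paths joining three points to three points cannot be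
chosen so that any two of them without a common end are disjoint. -/
theorem Path.exists_inter_of_three_three (p q : Fin 3 → ℂ) (γ : ∀ i j, Path (p i) (q j)) :
    ∃ i j k l, i ≠ k ∧ j ≠ l ∧ ∃ s t, γ i j s = γ k l t := by
  by_contra! H
  have hpp : ∀ i k, i ≠ k → p i ≠ p k := fun i k hik => by
    simpa using H i 0 k 1 hik (by simp) 0 0
  have hqq : ∀ j l, j ≠ l → q j ≠ q l := fun j l hjl => by
    simpa using H 0 j 1 l (by simp) hjl 1 1
  have hpq : ∀ i j, p i ≠ q j := fun i j => by
    obtain ⟨k, hk⟩ := exists_ne i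
    obtain ⟨l, hl⟩ := exists_ne j
    simpa using H i l k j hk.symm hl 0 1
  -- `γ i j` misses `p k` because `p k` is also an end of some `γ k l` with `l ≠ j`. The value `0`
  -- at `i = k` only makes the chosen function total.
  have hN : ∀ i j k, ∃ n : ℤ, i ≠ k → (γ i j).IsTurns (p k) n := fun i j k => by
    by_cases hik : i = k
    · exact ⟨0, fun h => (h hik).elim⟩
    obtain ⟨l, hl⟩ := exists_ne j
    obtain ⟨n, hn⟩ := (γ i j).exists_isTurns (w := p k)
      (fun s => by simpa using H i j k l hik hl.symm s 0)
    exact ⟨n, fun _ => hn⟩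
  have hM : ∀ i j l, ∃ n : ℤ, j ≠ l → (γ i j).IsTurns (q l) n := fun i j l => by
    by_cases hjl : j = l
    · exact ⟨0, fun h => (h hjl).elim⟩
    obtain ⟨k, hk⟩ := exists_ne i
    obtain ⟨n, hn⟩ := (γ i j).exists_isTurns (w := q l)
      (fun s => by simpa using H i j k l hk.symm hjl s 1)
    exact ⟨n, fun _ => hn⟩
  have hP : ∀ i k, ∃ n : ℤ, i ≠ k →
      Complex.log (p i - p k) - Complex.log (p k - p i) = (2 * n + 1) * (Real.pi * Complex.I) :=
    fun i k => by
      by_cases hik : i = k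
      · exact ⟨0, fun h => (h hik).elim⟩
      obtain ⟨n, hn⟩ := Complex.exists_log_sub_comm (hpp i k hik)
      exact ⟨n, fun _ => hn⟩
  have hQ : ∀ j l, ∃ n : ℤ, j ≠ l →
      Complex.log (q j - q l) - Complex.log (q l - q j) = (2 * n + 1) * (Real.pi * Complex.I) :=
    fun j l => by
      by_cases hjl : j = l
      · exact ⟨0, fun h => (h hjl).elim⟩
      obtain ⟨n, hn⟩ := Complex.exists_log_sub_comm (hqq j l hjl)
      exact ⟨n, fun _ => hn⟩
  have hT : ∀ j i, ∃ n : ℤ,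
      Complex.log (q j - p i) - Complex.log (p i - q j) = (2 * n + 1) * (Real.pi * Complex.I) :=
    fun j i => Complex.exists_log_sub_comm (hpq i j).symm
  choose N hN using hN
  choose M hM using hM
  choose P hP using hP
  choose Q hQ using hQ
  choose T hT using hT
  have hQanti : ∀ j l, j ≠ l → Q j l + Q l j + 1 = 0 := fun j l hjl => by
    have h1 := hQ j l hjl
    have h2 := hQ l j hjl.symm
    have : ((Q j l + Q l j + 1 : ℤ) : ℂ) * (2 * Real.pi * Complex.I) = 0 := by
      push_cast
      linear_combination -h1 - h2
    exact_mod_cast (mul_eq_zero.1 this).resolve_right Complex.two_pi_I_ne_zero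
  have rel : ∀ i j k l, i ≠ k → j ≠ l →
      P k i + Q l j + T j k + (-T l i - 1) + 2 + N i j k + M k l j - M i j l - N k l i = 0 :=
    fun i j k l hik hjl => Path.turns_relation (γ i j) (γ k l) (H i j k l hik hjl)
      (hN i j k hik) (hM i j l hjl) (hN k l i hik.symm) (hM k l j hjl.symm)
      (hP k i hik.symm) (hQ l j hjl.symm) (hT j k)
      -- Reversing the difference turns `2 * T + 1` into `-(2 * T + 1) = 2 * (-T - 1) + 1`.
      (by push_cast; linear_combination -hT l i)
  have r := fun i j k l (h : i ≠ k ∧ j ≠ l) => rel i j k l h.1 h.2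
  -- In the sum of the eighteen relations each `N`, `M`, `T` and `P` has an even coefficient and the
  -- constants add up to 18. Each of the three sums `Q j l + Q l j = -1` occurs three times, which
  -- leaves an odd number.
  have := r 0 0 1 1 (by decide)
  have := r 0 0 1 2 (by decide)
  have := r 0 1 1 0 (by decide)
  have := r 0 1 1 2 (by decide)
  have := r 0 2 1 0 (by decide)
  have := r 0 2 1 1 (by decide)
  have := r 0 0 2 1 (by decide)
  have := r 0 0 2 2 (by decide)
  have := r 0 1 2 0 (by decide)
  have := r 0 1 2 2 (by decide)
  have := r 0 2 2 0 (by decide)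
  have := r 0 2 2 1 (by decide)
  have := r 1 0 2 1 (by decide)
  have := r 1 0 2 2 (by decide)
  have := r 1 1 2 0 (by decide)
  have := r 1 1 2 2 (by decide)
  have := r 1 2 2 0 (by decide)
  have := r 1 2 2 1 (by decide)
  have := hQanti 0 1 (by decide)
  have := hQanti 0 2 (by decide)
  have := hQanti 1 2 (by decide)
  clear rel r hN hM hP hQ hT hQanti
  omega

/-! ### From plane embeddings to disjoint regions -/

namespace PlaneEmbedding

variable {V : Type*} {G : SimpleGraph V}

theorem point_mem_arc (E : PlaneEmbedding G) {e : Sym2 V} (he : e ∈ G.edgeSet) {v : V}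
    (hv : v ∈ e) : E.point v ∈ E.arc e := by
  obtain ⟨w, rfl⟩ := hv
  obtain ⟨γ, -, hγ⟩ := E.isArc v w he
  exact hγ ▸ ⟨0, by simp⟩

/-- `E.drawing Sᶜ` draws the subgraph induced by `S`. A point common to two distinct arcs is a
vertex incident with both edges, so it would lie in `S ∩ T`. -/
theorem disjoint_drawing_compl (E : PlaneEmbedding G) {S T : Set V} (h : Disjoint S T) :
    Disjoint (E.drawing Sᶜ) (E.drawing Tᶜ) := by
  have hV : ∀ {v w}, v ∈ S → w ∈ T → v ≠ w := fun hv hw => h.ne_of_mem hv hw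
  rw [Set.disjoint_left]
  rintro x (⟨v, hv, rfl⟩ | hx) (⟨w, hw, hwx⟩ | hx')
  · exact hV (not_not.1 hv) (not_not.1 hw) (E.point_injective hwx.symm)
  · simp only [Set.mem_iUnion] at hx'
    obtain ⟨f, ⟨hf, hfT⟩, hxf⟩ := hx'
    exact hV (not_not.1 hv) (not_not.1 (hfT v (E.mem_of_point_mem_arc f hf v hxf))) rfl
  · simp only [Set.mem_iUnion] at hx
    obtain ⟨e, ⟨he, heS⟩, hxe⟩ := hx
    rw [← hwx] at hxe
    exact hV (not_not.1 (heS w (E.mem_of_point_mem_arc e he w hxe))) (not_not.1 hw) rfl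
  · simp only [Set.mem_iUnion] at hx hx'
    obtain ⟨e, ⟨he, heS⟩, hxe⟩ := hx
    obtain ⟨f, ⟨hf, hfT⟩, hxf⟩ := hx'
    by_cases hef : e = f
    · subst hef
      have := e.out_fst_mem
      exact hV (not_not.1 (heS _ this)) (not_not.1 (hfT _ this)) rfl
    · obtain ⟨w, hw, rfl⟩ := E.endpoint_of_mem_arcs e he f hf hef x hxe hxf
      exact hV (not_not.1 (heS w hw)) (not_not.1 (hfT w (E.mem_of_point_mem_arc f hf w hxf))) rfl

theorem joinedIn_drawing_compl (E : PlaneEmbedding G) {S : Set V} {u v : V} (h : G.Adj u v)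
    (hu : u ∈ S) (hv : v ∈ S) : JoinedIn (E.drawing Sᶜ) (E.point u) (E.point v) := by
  obtain ⟨γ, -, hγ⟩ := E.isArc u v h
  refine ⟨γ, fun s => Or.inr ?_⟩
  simp only [Set.mem_iUnion]
  exact ⟨s(u, v), ⟨h, by simp [hu, hv]⟩, hγ ▸ ⟨s, rfl⟩⟩

end PlaneEmbedding

namespace SimpleGraph

variable {α : Type*}

/-- The vertices are points of the plane and every vertex set `S` has a region `D S` in which
the adjacent vertices of `S` are linked, in such a way that disjoint sets have disjoint regions. -/
def HasDisjointRegions (G : SimpleGraph α) : Prop :=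
  ∃ (pt : α → ℂ) (D : Set α → Set ℂ), (∀ S T, Disjoint S T → Disjoint (D S) (D T)) ∧
    ∀ S, ∀ u ∈ S, ∀ v ∈ S, G.Adj u v → JoinedIn (D S) (pt u) (pt v)

/-- `u` and `v` are linked by a walk in `G` of positive length, all of whose vertices are in `S`. -/
def LinkedIn (G : SimpleGraph α) (S : Set α) : α → α → Prop :=
  Relation.TransGen fun u v => u ∈ S ∧ v ∈ S ∧ G.Adj u v

/-- The region of `S` is the drawing of the subgraph induced by `S`, carried to `ℂ`. Passing to the
ambient type `α` frees later arguments from the subtype of vertices. -/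
theorem IsPlanar.hasDisjointRegions_map {V : Set α} {G : SimpleGraph V} (hG : G.IsPlanar) :
    (G.map (Function.Embedding.subtype (· ∈ V))).HasDisjointRegions := by
  obtain ⟨E⟩ := hG
  classical
  let φ : Plane → ℂ := fun x => ⟨x 0, x 1⟩
  have hφ : Continuous φ := by
    have : φ = fun x => (x 0 : ℂ) + x 1 * Complex.I := by
      ext x
      exact Complex.mk_eq_add_mul_I _ _
    rw [this]
    fun_prop
  have hinj : Function.Injective φ := fun x y h => by
    ext i
    fin_cases i
    · exact congrArg Complex.re h
    · exact congrArg Complex.im h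
  refine ⟨fun v => if h : v ∈ V then φ (E.point ⟨v, h⟩) else 0,
    fun S => φ '' E.drawing {v : V | (v : α) ∈ S}ᶜ, fun S T h => ?_, ?_⟩
  · rw [Set.disjoint_image_iff hinj]
    exact E.disjoint_drawing_compl (h.preimage _)
  · rintro S _ hu' _ hv' ⟨-, ⟨u, hu⟩, ⟨v, hv⟩, h, rfl, rfl⟩
    obtain ⟨γ, hγ⟩ := E.joinedIn_drawing_compl h (S := {v : V | (v : α) ∈ S}) hu' hv'
    have : JoinedIn (φ '' E.drawing {v : V | (v : α) ∈ S}ᶜ) (φ (E.point ⟨u, hu⟩))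
        (φ (E.point ⟨v, hv⟩)) := ⟨γ.map hφ, fun s => ⟨_, hγ s, rfl⟩⟩
    simpa [hu, hv] using this

/-- Walks that form a subdivision of `K₃,₃` do not exist in planar graphs. -/
theorem HasDisjointRegions.exists_not_disjoint {G : SimpleGraph α} (hG : G.HasDisjointRegions)
    (p q : Fin 3 → α) (S : Fin 3 → Fin 3 → Set α) (h : ∀ i j, G.LinkedIn (S i j) (p i) (q j)) :
    ∃ i j k l, i ≠ k ∧ j ≠ l ∧ ¬ Disjoint (S i j) (S k l) := by
  obtain ⟨pt, D, hD, hpt⟩ := hG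
  have hJ : ∀ i j, JoinedIn (D (S i j)) (pt (p i)) (pt (q j)) := fun i j => by
    have := h i j
    generalize p i = x, q j = y at this
    induction this with
    | single h => exact hpt _ _ h.1 _ h.2.1 h.2.2
    | tail _ h ih => exact ih.trans (hpt _ _ h.1 _ h.2.1 h.2.2)
  choose γ hγ using hJ
  obtain ⟨i, j, k, l, hik, hjl, s, t, hst⟩ := Path.exists_inter_of_three_three _ _ γ
  exact ⟨i, j, k, l, hik, hjl, fun hd =>
    Set.disjoint_left.1 (hD _ _ hd) (hγ i j s) (hst ▸ hγ k l t)⟩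

theorem Adj.linkedIn {G : SimpleGraph α} {S : Set α} {u v : α} (h : G.Adj u v) (hu : u ∈ S)
    (hv : v ∈ S) : G.LinkedIn S u v :=
  .single ⟨hu, hv, h⟩

/-- `K₃,₃` is not planar. -/
theorem HasDisjointRegions.false_of_crossing {G : SimpleGraph α} (hG : G.HasDisjointRegions)
    {x y z a b d : α} (hnd : [x, y, z, a, b, d].Nodup)
    (hxa : G.Adj a x) (hxb : G.Adj b x) (hya : G.Adj a y) (hyb : G.Adj b y)
    (hda : G.Adj a d) (hdb : G.Adj b d) (hxz : G.Adj z x) (hyz : G.Adj z y) (hdz : G.Adj z d) :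
    False := by
  -- Here every walk is a single edge.
  obtain ⟨i, j, k, l, hik, hjl, hd⟩ := hG.exists_not_disjoint ![a, b, z] ![x, y, d]
    (fun i j => {![a, b, z] i, ![x, y, d] j}) (fun i j => by
      refine Adj.linkedIn ?_ (by simp) (by simp)
      fin_cases i <;> fin_cases j <;> assumption)
  have h1 : Function.Injective ![a, b, z] := by
    intro i j; fin_cases i <;> fin_cases j <;> simp <;> grind
  have h2 : Function.Injective ![x, y, d] := by
    intro i j; fin_cases i <;> fin_cases j <;> simp <;> grind
  have h3 : ∀ i j, ![a, b, z] i ≠ ![x, y, d] j := by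
    intro i j; fin_cases i <;> fin_cases j <;> simp <;> grind
  apply hd
  simp [h1.eq_iff, h2.eq_iff, hik.symm, hjl.symm, h3, (h3 _ _).symm]

/-- A triangle `a b d` with a vertex `c` joined to `a`, `b`, `d` and a path `x z y` with edges `x a`,
`z d`, `y b`, where `y` is linked to `c` by a walk that avoids the other vertices: this contains a
subdivision of `K₃,₃`. -/
theorem HasDisjointRegions.false_of_link {G : SimpleGraph α} (hG : G.HasDisjointRegions)
    {x y z a b c d : α} (hnd : [x, y, z, a, b, c, d].Nodup)
    (hzy : G.Adj z y) (hzx : G.Adj z x) (hxa : G.Adj x a) (hzd : G.Adj z d) (hby : G.Adj b y)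
    (hba : G.Adj b a) (hbd : G.Adj b d) (hca : G.Adj c a) (hcd : G.Adj c d)
    {P : Set α} (hP : G.LinkedIn P c y) (hPd : ∀ v ∈ P, v ∉ [x, z, a, b, d]) :
    False := by
  -- Branch vertices `z`, `b`, `c` against `y`, `a`, `d`. The path `z x a` replaces the edge `z a`,
  -- and the walk in `P` replaces `c y`.
  obtain ⟨i, j, k, l, hik, hjl, hd⟩ := hG.exists_not_disjoint ![z, b, c] ![y, a, d]
    ![![{z, y}, {z, x, a}, {z, d}], ![{b, y}, {b, a}, {b, d}], ![P, {c, a}, {c, d}]] (by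
      intro i j
      fin_cases i <;> fin_cases j
      · exact hzy.linkedIn (by simp) (by simp)
      · exact (hzx.linkedIn (by simp) (by simp)).trans (hxa.linkedIn (by simp) (by simp))
      · exact hzd.linkedIn (by simp) (by simp)
      · exact hby.linkedIn (by simp) (by simp)
      · exact hba.linkedIn (by simp) (by simp)
      · exact hbd.linkedIn (by simp) (by simp)
      · exact hP
      · exact hca.linkedIn (by simp) (by simp)
      · exact hcd.linkedIn (by simp) (by simp))
  apply hd
  have hx := fun h => hPd x h (by simp)
  have hz := fun h => hPd z h (by simp)
  have ha := fun h => hPd a h (by simp)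
  have hb := fun h => hPd b h (by simp)
  have hd := fun h => hPd d h (by simp)
  simp only [List.nodup_cons, List.mem_cons, List.not_mem_nil, not_or, or_false, List.nodup_nil] at hnd
  fin_cases i <;> fin_cases j <;> fin_cases k <;> fin_cases l <;>
    first
      | exact absurd rfl hik
      | exact absurd rfl hjl
      | (simp [*]; done)
      | (simp [*]; grind)

end SimpleGraph

/-! ### The planar obstruction in the example -/

open SimpleGraph

namespace TwinExample

open Vert

/-- The solid edges, as a list of pairs. -/
def solidPairs : List (Vert × Vert) :=
  [(a, b), (a, c), (a, d), (b, c), (b, d), (c, d),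
   (a, va), (va, vd), (vd, vb), (vb, b), (d, vd),
   (b, ub), (ub, ud), (ud, uc), (uc, c), (d, ud)]

/-- The dotted edges, as a list of pairs. -/
def dottedPairs : List (Vert × Vert) :=
  [(a, t), (b, t), (va, t), (vb, t), (c, t'), (b, t'), (ub, t'), (uc, t')]

theorem mk_mem_setOf_pairs {L : List (Vert × Vert)} {x y : Vert} :
    s(x, y) ∈ {e | ∃ p ∈ L, s(p.1, p.2) = e} ↔ (x, y) ∈ L ∨ (y, x) ∈ L := by
  constructor
  · rintro ⟨⟨u, v⟩, hp, h⟩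
    rcases Sym2.eq_iff.1 h with ⟨rfl, rfl⟩ | ⟨rfl, rfl⟩
    · exact .inl hp
    · exact .inr hp
  · rintro (h | h)
    · exact ⟨_, h, rfl⟩
    · exact ⟨_, h, Sym2.eq_swap⟩

theorem mk_mem_solidEdges {x y : Vert} :
    s(x, y) ∈ solidEdges ↔ (x, y) ∈ solidPairs ∨ (y, x) ∈ solidPairs := by
  rw [← mk_mem_setOf_pairs]
  simp only [solidEdges, solidPairs, Set.mem_insert_iff, Set.mem_singleton_iff, Set.mem_ofPred_eq,
    List.mem_cons, List.not_mem_nil, or_and_right, exists_or, exists_eq_left, or_false,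
    eq_comm (b := s(x, y))]

theorem mk_mem_dottedEdges {x y : Vert} :
    s(x, y) ∈ dottedEdges ↔ (x, y) ∈ dottedPairs ∨ (y, x) ∈ dottedPairs := by
  rw [← mk_mem_setOf_pairs]
  simp only [dottedEdges, dottedPairs, Set.mem_insert_iff, Set.mem_singleton_iff, Set.mem_ofPred_eq,
    List.mem_cons, List.not_mem_nil, or_and_right, exists_or, exists_eq_left, or_false,
    eq_comm (b := s(x, y))]

/-- Here `t₀` is the surviving twin, and `h₁` to `h₄` list the possible neighbours forced by the
large hyperedges. All but `t₀` are limited by `K₃,₃`, and the resulting route from `c` through `t₀`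
to the `v`-path is itself forbidden. -/
theorem false_of_hasDisjointRegions {G : SimpleGraph Vert} (hG : G.HasDisjointRegions) {t₀ : Vert}
    (ht₀ : t₀ = t ∨ t₀ = t')
    (hs : ∀ x y, (x, y) ∈ solidPairs ∨ (y, x) ∈ solidPairs → G.Adj x y)
    (h₁ : G.Adj vb a ∨ G.Adj vb c ∨ G.Adj vb t₀) (h₂ : G.Adj va b ∨ G.Adj va c ∨ G.Adj va t₀)
    (h₃ : G.Adj uc b ∨ G.Adj uc a ∨ G.Adj uc t₀) (h₄ : G.Adj ub c ∨ G.Adj ub a ∨ G.Adj ub t₀) :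
    False := by
  have hne : t₀ ∉ [a, b, c, d, va, vb, vd, ub, uc, ud] := by rcases ht₀ with rfl | rfl <;> decide
  have hvb : ∀ P, G.LinkedIn P c vb → (∀ v ∈ P, v ∉ [va, vd, a, b, d]) → False := fun P =>
    hG.false_of_link (by decide) (hs _ _ (by decide)) (hs _ _ (by decide))
      (hs _ _ (by decide)) (hs _ _ (by decide))
      (hs _ _ (by decide)) (hs _ _ (by decide))
      (hs _ _ (by decide)) (hs _ _ (by decide))
      (hs _ _ (by decide))
  have hva : ∀ P, G.LinkedIn P c va → (∀ v ∈ P, v ∉ [vb, vd, b, a, d]) → False := fun P =>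
    hG.false_of_link (by decide) (hs _ _ (by decide)) (hs _ _ (by decide))
      (hs _ _ (by decide)) (hs _ _ (by decide))
      (hs _ _ (by decide)) (hs _ _ (by decide))
      (hs _ _ (by decide)) (hs _ _ (by decide))
      (hs _ _ (by decide))
  have huc : ∀ P, G.LinkedIn P a uc → (∀ v ∈ P, v ∉ [ub, ud, b, c, d]) → False := fun P =>
    hG.false_of_link (by decide) (hs _ _ (by decide)) (hs _ _ (by decide))
      (hs _ _ (by decide)) (hs _ _ (by decide))
      (hs _ _ (by decide)) (hs _ _ (by decide))
      (hs _ _ (by decide)) (hs _ _ (by decide))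
      (hs _ _ (by decide))
  have hub : ∀ P, G.LinkedIn P a ub → (∀ v ∈ P, v ∉ [uc, ud, c, b, d]) → False := fun P =>
    hG.false_of_link (by decide) (hs _ _ (by decide)) (hs _ _ (by decide))
      (hs _ _ (by decide)) (hs _ _ (by decide))
      (hs _ _ (by decide)) (hs _ _ (by decide))
      (hs _ _ (by decide)) (hs _ _ (by decide))
      (hs _ _ (by decide))
  have hvbc : ¬ G.Adj vb c := fun h =>
    hvb {c, vb} (h.symm.linkedIn (by simp) (by simp)) (by simp)
  have hvac : ¬ G.Adj va c := fun h =>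
    hva {c, va} (h.symm.linkedIn (by simp) (by simp)) (by simp)
  have huca : ¬ G.Adj uc a := fun h =>
    huc {a, uc} (h.symm.linkedIn (by simp) (by simp)) (by simp)
  have huba : ¬ G.Adj ub a := fun h =>
    hub {a, ub} (h.symm.linkedIn (by simp) (by simp)) (by simp)
  -- `K₃,₃` with sides `a`, `b`, `vd` and `va`, `vb`, `d`.
  have hv : ¬ (G.Adj vb a ∧ G.Adj va b) := fun h =>
    hG.false_of_crossing (x := va) (y := vb) (z := vd) (a := a) (b := b) (d := d) (by decide)
      (hs _ _ (by decide)) h.2.symm h.1.symm (hs _ _ (by decide))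
      (hs _ _ (by decide)) (hs _ _ (by decide))
      (hs _ _ (by decide)) (hs _ _ (by decide))
      (hs _ _ (by decide))
  have hu : ¬ (G.Adj uc b ∧ G.Adj ub c) := fun h =>
    hG.false_of_crossing (x := ub) (y := uc) (z := ud) (a := b) (b := c) (d := d) (by decide)
      (hs _ _ (by decide)) h.2.symm h.1.symm (hs _ _ (by decide))
      (hs _ _ (by decide)) (hs _ _ (by decide))
      (hs _ _ (by decide)) (hs _ _ (by decide))
      (hs _ _ (by decide))
  -- If `uc t₀` is not an edge, `uc b` is; then `ub c` is not, so `ub t₀` is an edge and the route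
  -- runs along the whole `u`-path.
  have hut : ∀ Q, uc ∈ Q → ud ∈ Q → ub ∈ Q → c ∈ Q → t₀ ∈ Q → G.LinkedIn Q c t₀ := by
    intro Q h1 h2 h3 h4 h5
    have l1 : G.LinkedIn Q c uc := (hs _ _ (by decide)).linkedIn h4 h1
    have l2 : G.LinkedIn Q uc ud := (hs _ _ (by decide)).linkedIn h1 h2
    have l3 : G.LinkedIn Q ud ub := (hs _ _ (by decide)).linkedIn h2 h3
    by_cases h : G.Adj uc t₀
    · exact l1.trans (h.linkedIn h1 h5)
    · have h' := (h₃.resolve_right fun h' => h'.elim huca h)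
      exact ((l1.trans l2).trans l3).trans (Adj.linkedIn
        ((h₄.resolve_left fun h'' => hu ⟨h', h''⟩).resolve_left huba) h3 h5)
  simp only [List.mem_cons, List.not_mem_nil, or_false, not_or] at hne
  by_cases h : G.Adj vb t₀
  · exact hvb {uc, ud, ub, c, t₀, vb} ((hut _ (by simp) (by simp) (by simp) (by simp)
      (by simp)).trans (h.symm.linkedIn (by simp) (by simp))) (by simp [hne])
  · have h' := (h₁.resolve_right fun h' => h'.elim hvbc h)
    have h'' := (h₂.resolve_left fun h'' => hv ⟨h', h''⟩).resolve_left hvac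
    exact hva {uc, ud, ub, c, t₀, va} ((hut _ (by simp) (by simp) (by simp) (by simp)
      (by simp)).trans (h''.symm.linkedIn (by simp) (by simp))) (by simp [hne])

end TwinExample

/-! ### Supports and connectedness of hypergraphs -/

namespace Hypergraph

variable {α : Type*} {H : Hypergraph α}

/-- The first edge of a walk from `x` to `y` inside `F`. If `F` is a pair, this edge is `F` itself.
-/
theorem IsSupport.exists_adj {G : SimpleGraph H.vertexSet} (hG : H.IsSupport G) {F : Set α}
    (hF : F ∈ H.edgeSet) {x y : α} (hx : x ∈ F) (hy : y ∈ F) (hxy : x ≠ y) :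
    ∃ z ∈ F, z ≠ x ∧ (G.map (Function.Embedding.subtype (· ∈ H.vertexSet))).Adj x z := by
  have hV := H.subset_vertexSet_of_mem_edgeSet' hF
  obtain ⟨w⟩ := (hG F hF).preconnected ⟨⟨x, hV hx⟩, hx⟩ ⟨⟨y, hV hy⟩, hy⟩
  cases w with
  | nil => exact (hxy rfl).elim
  | @cons _ v _ h _ =>
    exact ⟨v.1, v.2, fun he => h.ne (Subtype.ext (Subtype.ext he.symm)), ⟨(fun he =>
      h.ne (Subtype.ext (Subtype.ext he))), _, _, h, rfl, rfl⟩⟩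

theorem mem_edgeSet_removeVertices {S F : Set α} (hF : F ∈ H.edgeSet) {x y : α} (hx : x ∈ F \ S)
    (hy : y ∈ F \ S) (hxy : x ≠ y) : F \ S ∈ (H.removeVertices S).edgeSet :=
  ⟨⟨F, hF, rfl⟩, x, hx, y, hy, hxy⟩

/-- It is enough to reach every vertex of a hyperedge from one root; the root is exempt since
`LinkedIn` requires positive length. -/
theorem isSupport_of_transGen {G : SimpleGraph H.vertexSet}
    (h : ∀ F ∈ H.edgeSet, ∃ r : H.vertexSet, (r : α) ∈ F ∧ ∀ v : H.vertexSet, (v : α) ∈ F → v ≠ r →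
      G.LinkedIn {v | (v : α) ∈ F} r v) : H.IsSupport G := by
  intro F hF
  obtain ⟨r, hr, h⟩ := h F hF
  have key : ∀ v : H.vertexSet, G.LinkedIn {v | (v : α) ∈ F} r v → ∃ hv : (v : α) ∈ F,
      (G.induce {v : H.vertexSet | (v : α) ∈ F}).Reachable ⟨r, hr⟩ ⟨v, hv⟩ := by
    intro v hv
    induction hv with
    | single h => exact ⟨h.2.1, Adj.reachable (G := G.induce _) (u := ⟨_, _⟩) (v := ⟨_, _⟩) h.2.2⟩
    | tail _ h ih =>
      obtain ⟨_, ih⟩ := ih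
      exact ⟨h.2.1, ih.trans (Adj.reachable (G := G.induce _) (u := ⟨_, _⟩) (v := ⟨_, _⟩) h.2.2)⟩
  rw [connected_iff_exists_forall_reachable]
  refine ⟨⟨r, hr⟩, fun ⟨v, hv⟩ => ?_⟩
  by_cases hvr : v = r
  · subst hvr; exact .refl _
  · exact (key v (h v hv hvr)).2

theorem isConnected_of_reflTransGen {r : α} (hr : r ∈ H.vertexSet)
    (h : ∀ v ∈ H.vertexSet, Relation.ReflTransGen H.Adj r v) : H.IsConnected := by
  have : Std.Symm H.Adj := ⟨fun _ _ h => h.symm⟩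
  exact ⟨⟨r, hr⟩, fun u hu v hv => (Relation.ReflTransGen.stdSymm.symm _ _ (h u hu)).trans (h v hv)⟩

end Hypergraph

/-! ### The example: no planar support after deletion, connectedness, twins, support -/

namespace TwinExample

open Vert

theorem pair_mem_edgeSet {x y : Vert} (h : (x, y) ∈ solidPairs ∨ (y, x) ∈ solidPairs) :
    {x, y} ∈ H.edgeSet :=
  .inl ⟨x, y, mk_mem_solidEdges.2 h, rfl⟩

theorem not_hasPlanarSupport_removeVertices {t₀ t₁ : Vert}
    (h : t₀ = t ∧ t₁ = t' ∨ t₀ = t' ∧ t₁ = t) :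
    ¬ (H.removeVertices {t₁}).HasPlanarSupport := by
  rintro ⟨G, hG, hp⟩
  have hne : t₁ ∉ [a, b, c, d, va, vb, vd, ub, uc, ud] := by
    rcases h with ⟨-, rfl⟩ | ⟨-, rfl⟩ <;> decide
  simp only [List.mem_cons, List.not_mem_nil, or_false, not_or] at hne
  obtain ⟨ha, hb, hc, hd, hva, hvb, hvd, hub, huc, hud⟩ := hne
  have large : ∀ {x y : Vert} {F : Set Vert}, F ∈ largeHyperedges → x ∈ F → y ∈ F → x ≠ y →
      x ≠ t₁ → y ≠ t₁ → ∃ z ∈ F, z ≠ t₁ ∧ z ≠ x ∧ (G.map (Function.Embedding.subtype _)).Adj x z := by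
    intro x y F hF hx hy hxy hxt hyt
    obtain ⟨z, ⟨hz, hzt⟩, hzx, hz'⟩ := hG.exists_adj (Hypergraph.mem_edgeSet_removeVertices (.inr hF)
      ⟨hx, hxt⟩ ⟨hy, hyt⟩ hxy) ⟨hx, hxt⟩ ⟨hy, hyt⟩ hxy
    exact ⟨z, hz, hzt, hzx, hz'⟩
  refine false_of_hasDisjointRegions (t₀ := t₀) hp.hasDisjointRegions_map (by tauto) ?_ ?_ ?_ ?_ ?_
  · intro x y hxy
    have hsolid : ∀ p ∈ solidPairs, p.1 ∉ [t, t'] ∧ p.2 ∉ [t, t'] ∧ p.1 ≠ p.2 := by decide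
    have ht₁ : t₁ ∈ [t, t'] := by rcases h with ⟨-, rfl⟩ | ⟨-, rfl⟩ <;> decide
    have hx : x ≠ t₁ := by rintro rfl; rcases hxy with h | h <;> have := hsolid _ h <;> tauto
    have hy : y ≠ t₁ := by rintro rfl; rcases hxy with h | h <;> have := hsolid _ h <;> tauto
    have hxy' : x ≠ y := by
      rintro rfl; rcases hxy with h | h <;> exact (hsolid _ h).2.2 rfl
    obtain ⟨z, ⟨hz, -⟩, hzx, hz'⟩ := hG.exists_adj (Hypergraph.mem_edgeSet_removeVertices
      (pair_mem_edgeSet hxy) ⟨by simp, hx⟩ ⟨by simp, hy⟩ hxy') ⟨by simp, hx⟩ ⟨by simp, hy⟩ hxy'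
    rcases hz with rfl | rfl
    · exact (hzx rfl).elim
    · exact hz'
  · obtain ⟨z, hz, hzt, hzx, hz'⟩ := large (x := vb) (y := a) (F := {a, vb, t, t', c})
      (by simp [largeHyperedges]) (by simp) (by simp) (by decide) (Ne.symm hvb) (Ne.symm ha)
    rcases h with ⟨rfl, rfl⟩ | ⟨rfl, rfl⟩ <;> rcases hz with rfl | rfl | rfl | rfl | rfl <;> tauto
  · obtain ⟨z, hz, hzt, hzx, hz'⟩ := large (x := va) (y := b) (F := {b, va, t, t', c})
      (by simp [largeHyperedges]) (by simp) (by simp) (by decide) (Ne.symm hva) (Ne.symm hb)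
    rcases h with ⟨rfl, rfl⟩ | ⟨rfl, rfl⟩ <;> rcases hz with rfl | rfl | rfl | rfl | rfl <;> tauto
  · obtain ⟨z, hz, hzt, hzx, hz'⟩ := large (x := uc) (y := b) (F := {b, uc, t, t', a})
      (by simp [largeHyperedges]) (by simp) (by simp) (by decide) (Ne.symm huc) (Ne.symm hb)
    rcases h with ⟨rfl, rfl⟩ | ⟨rfl, rfl⟩ <;> rcases hz with rfl | rfl | rfl | rfl | rfl <;> tauto
  · obtain ⟨z, hz, hzt, hzx, hz'⟩ := large (x := ub) (y := c) (F := {c, ub, t, t', a})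
      (by simp [largeHyperedges]) (by simp) (by simp) (by decide) (Ne.symm hub) (Ne.symm hc)
    rcases h with ⟨rfl, rfl⟩ | ⟨rfl, rfl⟩ <;> rcases hz with rfl | rfl | rfl | rfl | rfl <;> tauto

theorem isConnected_of_adj {H' : Hypergraph Vert} (h : ∀ p ∈ solidPairs, H'.Adj p.1 p.2)
    (ht : t ∈ H'.vertexSet → H'.Adj a t) (ht' : t' ∈ H'.vertexSet → H'.Adj a t') (ha : a ∈ H'.vertexSet) :
    H'.IsConnected := by
  have hva := h (a, va) (by decide)
  have hb := h (a, b) (by decide)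
  have hub := h (b, ub) (by decide)
  refine Hypergraph.isConnected_of_reflTransGen ha fun v hv => ?_
  cases v with
  | a => exact .refl
  | b => exact .single hb
  | c => exact .single (h (a, c) (by decide))
  | d => exact .single (h (a, d) (by decide))
  | va => exact .single hva
  | vb => exact .tail (.single hb) (h (vb, b) (by decide)).symm
  | vd => exact .tail (.single hva) (h (va, vd) (by decide))
  | ub => exact .tail (.single hb) hub
  | uc => exact .tail (.single (h (a, c) (by decide))) (h (uc, c) (by decide)).symm
  | ud => exact .tail (.tail (.single hb) hub) (h (ub, ud) (by decide))
  | t => exact .single (ht hv)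
  | t' => exact .single (ht' hv)

theorem isConnected_H : H.IsConnected := by
  refine isConnected_of_adj (fun p hp => ⟨_, pair_mem_edgeSet (.inl hp), by simp, by simp⟩)
    (fun _ => ⟨{a, va, t, t', c}, .inr (by simp [largeHyperedges]), by simp, by simp⟩)
    (fun _ => ⟨{a, va, t, t', c}, .inr (by simp [largeHyperedges]), by simp, by simp⟩) trivial

theorem isConnected_removeVertices {t₁ : Vert} (h : t₁ = t ∨ t₁ = t') :
    (H.removeVertices {t₁}).IsConnected := by
  have hne : a ≠ t₁ := by rcases h with rfl | rfl <;> decide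
  have hsolid : ∀ p ∈ solidPairs, p.1 ≠ t₁ ∧ p.2 ≠ t₁ ∧ p.1 ≠ p.2 := by
    rcases h with rfl | rfl <;> decide
  have hlarge : ∀ x, (x = t ∨ x = t') → x ∈ (H.removeVertices {t₁}).vertexSet →
      (H.removeVertices {t₁}).Adj a x := by
    rintro x hx ⟨-, hxt⟩
    have hxF : x ∈ ({a, va, t, t', c} : Set Vert) \ {t₁} := ⟨by rcases hx with rfl | rfl <;> simp, hxt⟩
    exact ⟨_, Hypergraph.mem_edgeSet_removeVertices (F := {a, va, t, t', c})
      (.inr (by simp [largeHyperedges])) ⟨by simp, hne⟩ hxF (by rcases hx with rfl | rfl <;> decide),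
      ⟨by simp, hne⟩, hxF⟩
  refine isConnected_of_adj (fun p hp => ?_) (hlarge t (.inl rfl)) (hlarge t' (.inr rfl))
    ⟨trivial, hne⟩
  obtain ⟨h1, h2, h3⟩ := hsolid p hp
  exact ⟨_, Hypergraph.mem_edgeSet_removeVertices (pair_mem_edgeSet (.inl hp)) ⟨by simp, h1⟩
    ⟨by simp, h2⟩ h3, ⟨by simp, h1⟩, ⟨by simp, h2⟩⟩

theorem areTwins : H.AreTwins t t' := by
  refine ⟨trivial, trivial, ?_⟩
  ext F
  simp only [Set.mem_ofPred_eq]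
  refine and_congr_right fun hF => ?_
  rcases hF with ⟨x, y, hxy, rfl⟩ | hF
  · have hsolid : ∀ p ∈ solidPairs, p.1 ∉ [t, t'] ∧ p.2 ∉ [t, t'] := by decide
    rcases mk_mem_solidEdges.1 hxy with h | h <;> have := hsolid _ h <;>
    simp only [List.mem_cons, List.not_mem_nil, or_false, not_or, Set.mem_insert_iff,
      Set.mem_singleton_iff] at * <;> simp [eq_comm, *]
  · rcases hF with rfl | rfl | rfl | rfl | rfl | rfl | rfl | rfl <;> simp

theorem drawnGraph_adj {x y : H.vertexSet} : drawnGraph.Adj x y ↔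
    (x.1, y.1) ∈ solidPairs ++ dottedPairs ∨ (y.1, x.1) ∈ solidPairs ++ dottedPairs := by
  have h : ∀ p ∈ solidPairs ++ dottedPairs, p.1 ≠ p.2 := by decide
  have h' := h (x.1, y.1)
  have h'' := h (y.1, x.1)
  simp only [drawnGraph, comap_adj, Function.Embedding.subtype_apply, fromEdgeSet_adj,
    Set.mem_union, mk_mem_solidEdges, mk_mem_dottedEdges, List.mem_append] at *
  tauto

theorem isSupport_drawnGraph : H.IsSupport drawnGraph := by
  have adj : ∀ {F : Set Vert} {x y : Vert}, x ∈ F → y ∈ F →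
      ((x, y) ∈ solidPairs ++ dottedPairs ∨ (y, x) ∈ solidPairs ++ dottedPairs) →
      drawnGraph.LinkedIn {v | (v : Vert) ∈ F} ⟨x, trivial⟩ ⟨y, trivial⟩ := fun hx hy h =>
    (drawnGraph_adj.2 h).linkedIn hx hy
  refine Hypergraph.isSupport_of_transGen fun F hF => ?_
  -- Every large hyperedge has a root from which its vertices are at distance at most two within the
  -- hyperedge, a condition decidable on lists.
  have key : ∀ (r : Vert) (L : List Vert), r ∈ L → (∀ v, v ∈ F ↔ v ∈ L) →
      (∀ v ∈ L, v ≠ r → ((r, v) ∈ solidPairs ++ dottedPairs ∨ (v, r) ∈ solidPairs ++ dottedPairs) ∨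
        ∃ w ∈ L, ((r, w) ∈ solidPairs ++ dottedPairs ∨ (w, r) ∈ solidPairs ++ dottedPairs) ∧
          ((w, v) ∈ solidPairs ++ dottedPairs ∨ (v, w) ∈ solidPairs ++ dottedPairs)) →
      ∃ r : H.vertexSet, (r : Vert) ∈ F ∧ ∀ v : H.vertexSet, (v : Vert) ∈ F → v ≠ r →
        drawnGraph.LinkedIn {v | (v : Vert) ∈ F} r v := by
    intro r L hr hL h
    refine ⟨⟨r, trivial⟩, (hL r).2 hr, fun ⟨v, _⟩ hv hvr => ?_⟩
    rcases h v ((hL v).1 hv) (fun h => hvr (Subtype.ext h)) with h | ⟨w, hw, h, h'⟩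
    · exact adj ((hL r).2 hr) hv h
    · exact (adj ((hL r).2 hr) ((hL w).2 hw) h).trans (adj ((hL w).2 hw) hv h')
  rcases hF with ⟨x, y, hxy, rfl⟩ | hF
  · refine ⟨⟨x, trivial⟩, by simp, fun ⟨v, _⟩ hv hvx => ?_⟩
    rcases hv with rfl | rfl
    · exact (hvx rfl).elim
    · exact adj (by simp) (by simp) (by have := mk_mem_solidEdges.1 hxy; simp; tauto)
  · rcases hF with rfl | rfl | rfl | rfl | rfl | rfl | rfl | rfl
    · exact key a [a, va, t, t', c] (by decide) (by simp) (by decide)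
    · exact key a [a, vb, t, t', c] (by decide) (by simp) (by decide)
    · exact key b [b, va, t, t', c] (by decide) (by simp) (by decide)
    · exact key b [b, vb, t, t', c] (by decide) (by simp) (by decide)
    · exact key b [b, ub, t, t', a] (by decide) (by simp) (by decide)
    · exact key b [b, uc, t, t', a] (by decide) (by simp) (by decide)
    · exact key c [c, ub, t, t', a] (by decide) (by simp) (by decide)
    · exact key c [c, uc, t, t', a] (by decide) (by simp) (by decide)

end TwinExample

/-! ### The straight-line drawing -/

namespace TwinExample

open Vert

/-- The first coordinate of a vertex in the straight-line drawing. -/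
def coordX : Vert → ℤ
  | a => -12 | b => 0 | c => 12 | d => 0 | va => -3 | vb => -3 | vd => -2
  | ub => 3 | uc => 3 | ud => 2 | t => -4 | t' => 4

/-- The second coordinate of a vertex in the straight-line drawing. -/
def coordY : Vert → ℤ
  | a => -9 | b => 12 | c => -9 | d => -1 | va => -1 | vb => 1 | vd => 0
  | ub => 1 | uc => -1 | ud => 0 | t => 0 | t' => 0

/-- The point of a vertex in the straight-line drawing. -/
noncomputable def pt (v : Vert) : Plane := !₂[(coordX v : ℝ), (coordY v : ℝ)]

/-- Twice the signed area of the triangle `u v w`. -/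
def orient (u v w : Vert) : ℤ :=
  (coordX v - coordX u) * (coordY w - coordY u) - (coordY v - coordY u) * (coordX w - coordX u)

@[simp]
theorem pt_apply_zero (v : Vert) : pt v 0 = coordX v := by simp [pt]

@[simp]
theorem pt_apply_one (v : Vert) : pt v 1 = coordY v := by simp [pt]

theorem pt_injective : Function.Injective pt := by
  intro u v h
  have h0 : coordX u = coordX v := by simpa using congrArg (fun x : Plane => x 0) h
  have h1 : coordY u = coordY v := by simpa using congrArg (fun x : Plane => x 1) h
  revert h0 h1
  cases u <;> cases v <;> simp [coordX, coordY]

theorem exists_of_mem_segment {u v : Vert} {x : Plane} (h : x ∈ segment ℝ (pt u) (pt v)) :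
    ∃ s t : ℝ, 0 ≤ s ∧ 0 ≤ t ∧ s + t = 1 ∧ x 0 = s * coordX u + t * coordX v ∧
      x 1 = s * coordY u + t * coordY v := by
  obtain ⟨s, t, hs, ht, hst, rfl⟩ := h
  exact ⟨s, t, hs, ht, hst, by simp [pt], by simp [pt]⟩

theorem convex_combination_ne_zero {s t x y : ℝ} (hs : 0 ≤ s) (ht : 0 ≤ t) (hst : s + t = 1)
    (h : 0 < x * y) : s * x + t * y ≠ 0 := by
  intro h0
  have hx : x ≠ 0 := left_ne_zero_of_mul h.ne'
  have h1 : s * (x * x) + t * (x * y) = 0 := by linear_combination x * h0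
  have h2 := mul_nonneg hs (mul_self_nonneg x)
  have h3 := mul_nonneg ht h.le
  have hs0 : s = 0 := (mul_eq_zero.1 (by linarith)).resolve_right (mul_self_pos.2 hx).ne'
  have ht0 : t = 0 := (mul_eq_zero.1 (by linarith)).resolve_right h.ne'
  linarith

/-- The affine function `orient u v ·` vanishes on the first segment; it is nonzero with the same
sign at `w` and `z`, hence nonzero on the second. -/
theorem disjoint_segment_of_orient {u v w z : Vert} (h : 0 < orient u v w * orient u v z) :
    Disjoint (segment ℝ (pt u) (pt v)) (segment ℝ (pt w) (pt z)) := by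
  rw [Set.disjoint_left]
  intro x hx hx'
  obtain ⟨s, t, hs, ht, hst, h0, h1⟩ := exists_of_mem_segment hx
  obtain ⟨s', t', hs', ht', hst', h0', h1'⟩ := exists_of_mem_segment hx'
  have hR : (0 : ℝ) < orient u v w * orient u v z := by exact_mod_cast h
  refine convex_combination_ne_zero hs' ht' hst' hR ?_
  obtain rfl : s = 1 - t := by linarith
  obtain rfl : s' = 1 - t' := by linarith
  simp only [orient]
  push_cast
  rw [h0] at h0'
  rw [h1] at h1'
  linear_combination ((coordY v : ℝ) - coordY u) * h0' - ((coordX v : ℝ) - coordX u) * h1'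

theorem eq_of_mem_segment_of_orient {u v w : Vert} (h : orient u v w ≠ 0) {x : Plane}
    (hx : x ∈ segment ℝ (pt u) (pt v)) (hx' : x ∈ segment ℝ (pt u) (pt w)) : x = pt u := by
  obtain ⟨s, t, hs, ht, hst, h0, h1⟩ := exists_of_mem_segment hx
  obtain ⟨s', t', hs', ht', hst', h0', h1'⟩ := exists_of_mem_segment hx'
  have hR : (orient u v w : ℝ) ≠ 0 := by exact_mod_cast h
  obtain rfl : s = 1 - t := by linarith
  obtain rfl : s' = 1 - t' := by linarith
  have key : t' * (orient u v w : ℝ) = 0 := by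
    simp only [orient]
    push_cast
    have e0 := h0.symm.trans h0'
    have e1 := h1.symm.trans h1'
    linear_combination ((coordY v : ℝ) - coordY u) * e0 - ((coordX v : ℝ) - coordX u) * e1
  obtain rfl : t' = 0 := (mul_eq_zero.1 key).resolve_right hR
  ext i
  fin_cases i
  · simpa [pt] using h0'
  · simpa [pt] using h1'

/-- A condition for the segments of two edges to meet at most in a common end. -/
def SegmentsCompatible (e f : Vert × Vert) : Prop :=
  0 < orient e.1 e.2 f.1 * orient e.1 e.2 f.2 ∨ 0 < orient f.1 f.2 e.1 * orient f.1 f.2 e.2 ∨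
  e.1 = f.1 ∧ orient e.1 e.2 f.2 ≠ 0 ∨ e.1 = f.2 ∧ orient e.1 e.2 f.1 ≠ 0 ∨
  e.2 = f.1 ∧ orient e.2 e.1 f.2 ≠ 0 ∨ e.2 = f.2 ∧ orient e.2 e.1 f.1 ≠ 0

instance : DecidableRel SegmentsCompatible := fun _ _ => by
  unfold SegmentsCompatible; infer_instance

theorem SegmentsCompatible.exists_eq {e f : Vert × Vert} (h : SegmentsCompatible e f) {x : Plane}
    (hx : x ∈ segment ℝ (pt e.1) (pt e.2)) (hx' : x ∈ segment ℝ (pt f.1) (pt f.2)) :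
    ∃ w, (w = e.1 ∨ w = e.2) ∧ x = pt w := by
  obtain ⟨u, v⟩ := e
  obtain ⟨w, z⟩ := f
  rcases h with h | h | ⟨rfl, h⟩ | ⟨rfl, h⟩ | ⟨rfl, h⟩ | ⟨rfl, h⟩
  · exact (Set.disjoint_left.1 (disjoint_segment_of_orient h) hx hx').elim
  · exact (Set.disjoint_left.1 (disjoint_segment_of_orient h) hx' hx).elim
  · exact ⟨u, .inl rfl, eq_of_mem_segment_of_orient h hx hx'⟩
  · exact ⟨u, .inl rfl, eq_of_mem_segment_of_orient h hx (segment_symm ℝ (pt w) _ ▸ hx')⟩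
  · exact ⟨v, .inr rfl, eq_of_mem_segment_of_orient h (segment_symm ℝ (pt u) _ ▸ hx) hx'⟩
  · exact ⟨v, .inr rfl, eq_of_mem_segment_of_orient h (segment_symm ℝ (pt u) _ ▸ hx)
      (segment_symm ℝ (pt w) _ ▸ hx')⟩

theorem segmentsCompatible : ∀ e ∈ solidPairs ++ dottedPairs, ∀ f ∈ solidPairs ++ dottedPairs,
    e ≠ f → SegmentsCompatible e f := by
  decide +kernel

/-- The segment of an edge in the straight-line drawing. -/
noncomputable def edgeSegment : Sym2 H.vertexSet → Set Plane :=
  Sym2.lift ⟨fun u v => segment ℝ (pt u) (pt v), fun _ _ => segment_symm _ _ _⟩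

theorem exists_pair_of_mem_edgeSet {e : Sym2 H.vertexSet} (he : e ∈ drawnGraph.edgeSet) :
    ∃ p ∈ solidPairs ++ dottedPairs, e = s(⟨p.1, trivial⟩, ⟨p.2, trivial⟩) := by
  induction e with | _ u v
  rcases drawnGraph_adj.1 he with h | h
  · exact ⟨_, h, rfl⟩
  · exact ⟨_, h, Sym2.eq_swap⟩

theorem exists_endpoint_of_mem_edgeSegment (e : Sym2 H.vertexSet) (he : e ∈ drawnGraph.edgeSet)
    (f : Sym2 H.vertexSet) (hf : f ∈ drawnGraph.edgeSet) (hef : e ≠ f) (x : Plane)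
    (hx : x ∈ edgeSegment e) (hx' : x ∈ edgeSegment f) : ∃ w ∈ e, x = pt w := by
  obtain ⟨p, hp, rfl⟩ := exists_pair_of_mem_edgeSet he
  obtain ⟨q, hq, rfl⟩ := exists_pair_of_mem_edgeSet hf
  obtain ⟨w, hw, rfl⟩ := (segmentsCompatible p hp q hq (by rintro rfl; exact hef rfl)).exists_eq
    hx hx'
  exact ⟨⟨w, trivial⟩, by rcases hw with rfl | rfl <;> simp, rfl⟩

theorem exists_incident_pair : ∀ v : Vert, ∃ p ∈ solidPairs ++ dottedPairs, v = p.1 ∨ v = p.2 := by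
  intro v; cases v <;> decide

/-- The straight-line drawing. -/
noncomputable def planeEmbedding : PlaneEmbedding drawnGraph where
  point v := pt v
  arc := edgeSegment
  point_injective := pt_injective.comp Subtype.val_injective
  isArc u v h := ⟨Path.segment _ _,
    Path.segment_injective_of_ne fun he => h.ne (Subtype.ext (pt_injective he)),
    Path.range_segment _ _⟩
  mem_of_point_mem_arc e he w hw := by
    -- No separate check of points against arcs is needed: `w` lies on the segment of an edge at
    -- `w`, so the check of pairs of edges applies.
    obtain ⟨p, hp, hwp⟩ := exists_incident_pair w
    have hf : s(⟨p.1, trivial⟩, ⟨p.2, trivial⟩) ∈ drawnGraph.edgeSet := drawnGraph_adj.2 (.inl hp)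
    by_cases hef : e = s(⟨p.1, trivial⟩, ⟨p.2, trivial⟩)
    · subst hef
      rcases hwp with h | h
      · simp [← h]
      · simp [← h]
    · have hw' : pt w ∈ segment ℝ (pt p.1) (pt p.2) := by
        rcases hwp with h | h
        · exact h ▸ left_mem_segment _ _ _
        · exact h ▸ right_mem_segment _ _ _
      obtain ⟨w', hw', h⟩ := exists_endpoint_of_mem_edgeSegment e he _ hf hef _ hw hw'
      rwa [Subtype.ext (pt_injective h)]
  endpoint_of_mem_arcs := exists_endpoint_of_mem_edgeSegment

/-- A condition for the open ray from `v` in direction `D` to avoid the segment of `e`. -/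
def RayAvoids (v : Vert) (D : ℤ × ℤ) (e : Vert × Vert) : Prop :=
  0 < (D.1 * (coordY e.1 - coordY v) - D.2 * (coordX e.1 - coordX v)) *
      (D.1 * (coordY e.2 - coordY v) - D.2 * (coordX e.2 - coordX v)) ∨
  D.1 * (coordX e.1 - coordX v) + D.2 * (coordY e.1 - coordY v) ≤ 0 ∧
    D.1 * (coordX e.2 - coordX v) + D.2 * (coordY e.2 - coordY v) ≤ 0 ∨
  0 ≤ orient e.1 e.2 v *
      ((coordX e.2 - coordX e.1) * D.2 - (coordY e.2 - coordY e.1) * D.1) ∧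
    (coordX e.2 - coordX e.1) * D.2 - (coordY e.2 - coordY e.1) * D.1 ≠ 0

instance (v : Vert) (D : ℤ × ℤ) : DecidablePred (RayAvoids v D) := fun _ => by
  unfold RayAvoids; infer_instance

theorem RayAvoids.notMem_segment {v : Vert} {D : ℤ × ℤ} {e : Vert × Vert} (h : RayAvoids v D e)
    (hD : D ≠ 0) {r : ℝ} (hr : 0 < r) :
    pt v + r • !₂[(D.1 : ℝ), (D.2 : ℝ)] ∉ segment ℝ (pt e.1) (pt e.2) := by
  intro hx
  obtain ⟨s, t, hs, ht, hst, h0, h1⟩ := exists_of_mem_segment hx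
  obtain rfl : s = 1 - t := by linarith
  simp only [pt, PiLp.add_apply, PiLp.smul_apply, smul_eq_mul,
    Matrix.cons_val_zero, Matrix.cons_val_one] at h0 h1
  rcases h with h | ⟨h, h'⟩ | ⟨h, h'⟩
  -- Both ends lie strictly on one side of the line carrying the ray.
  · have hR : (0 : ℝ) < (D.1 * (coordY e.1 - coordY v) - D.2 * (coordX e.1 - coordX v)) *
      (D.1 * (coordY e.2 - coordY v) - D.2 * (coordX e.2 - coordX v)) := by exact_mod_cast h
    exact convex_combination_ne_zero hs ht hst hR (by linear_combination D.2 * h0 - D.1 * h1)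
  -- Both ends lie in the closed half-plane behind `v`.
  · have hR : (D.1 : ℝ) * (coordX e.1 - coordX v) + D.2 * (coordY e.1 - coordY v) ≤ 0 := by
      exact_mod_cast h
    have hR' : (D.1 : ℝ) * (coordX e.2 - coordX v) + D.2 * (coordY e.2 - coordY v) ≤ 0 := by
      exact_mod_cast h'
    have hpos : (0 : ℝ) < D.1 * D.1 + D.2 * D.2 := by
      have : D.1 ≠ 0 ∨ D.2 ≠ 0 := by
        by_contra! hc
        exact hD (Prod.ext hc.1 hc.2)
      have : 0 < D.1 * D.1 + D.2 * D.2 := by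
        rcases this with h | h
        · nlinarith [mul_self_pos.2 h, mul_self_nonneg D.2]
        · nlinarith [mul_self_pos.2 h, mul_self_nonneg D.1]
      exact_mod_cast this
    have key : (1 - t) * ((D.1 : ℝ) * (coordX e.1 - coordX v) + D.2 * (coordY e.1 - coordY v)) +
        t * ((D.1 : ℝ) * (coordX e.2 - coordX v) + D.2 * (coordY e.2 - coordY v)) =
        r * (D.1 * D.1 + D.2 * D.2) := by
      linear_combination -D.1 * h0 - D.2 * h1
    nlinarith [mul_pos hr hpos]
  -- The ray's line crosses the line of `e` at the single parameter `r = -orient e.1 e.2 v / q`,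
  -- which is at most `0`.
  · set q : ℤ := (coordX e.2 - coordX e.1) * D.2 - (coordY e.2 - coordY e.1) * D.1 with hq
    have hqR : (q : ℝ) = (coordX e.2 - coordX e.1) * D.2 - (coordY e.2 - coordY e.1) * D.1 := by
      rw [hq]; push_cast; ring
    have hR : (0 : ℝ) ≤ orient e.1 e.2 v * q := by exact_mod_cast h
    have hR' : (q : ℝ) ≠ 0 := by exact_mod_cast h'
    have key : (orient e.1 e.2 v : ℝ) + r * q = 0 := by
      rw [hqR]
      simp only [orient]
      push_cast
      linear_combination ((coordX e.2 : ℝ) - coordX e.1) * h1 - ((coordY e.2 : ℝ) - coordY e.1) * h0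
    have h2 := mul_pos hr (mul_self_pos.2 hR')
    have h3 : (orient e.1 e.2 v : ℝ) * q + r * (q * q) = 0 := by linear_combination q * key
    linarith

end TwinExample

/-- The open ray is path-connected and unbounded, so it lies in one unbounded face, and `v` is in
its closure. -/
theorem PlaneEmbedding.mem_outerVertices_of_ray {V : Type*} {G : SimpleGraph V}
    (E : PlaneEmbedding G) {S : Set V} {v : V} (hv : v ∉ S) {D : Plane} (hD : D ≠ 0)
    (h : ∀ r : ℝ, 0 < r → E.point v + r • D ∉ E.drawing S) : v ∈ E.outerVertices S := by
  let f : ℝ → Plane := fun r => E.point v + r • D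
  have hf : Continuous f := by fun_prop
  have hR : f '' Set.Ioi 0 ⊆ pathComponentIn (E.drawing S)ᶜ (f 1) :=
    (((convex_Ioi (0 : ℝ)).isPathConnected ⟨1, Set.mem_Ioi.2 one_pos⟩).image hf).subset_pathComponentIn
      ⟨1, Set.mem_Ioi.2 one_pos, rfl⟩ (by rintro _ ⟨r, hr, rfl⟩; exact h r hr)
  refine ⟨hv, _, ⟨f 1, h 1 one_pos, rfl⟩, fun hb => ?_, closure_mono hR ?_⟩
  · obtain ⟨C, hC⟩ := (hb.subset hR).exists_norm_le
    have hD' : 0 < ‖D‖ := norm_pos_iff.2 hD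
    have hC0 : 0 ≤ C := (norm_nonneg _).trans (hC _ ⟨1, Set.mem_Ioi.2 one_pos, rfl⟩)
    have hr : 0 < (C + ‖E.point v‖ + 1) / ‖D‖ := by positivity
    have h1 := hC _ ⟨_, hr, rfl⟩
    have h2 : ‖((C + ‖E.point v‖ + 1) / ‖D‖) • D‖ = C + ‖E.point v‖ + 1 := by
      rw [norm_smul, Real.norm_of_nonneg hr.le, div_mul_cancel₀ _ hD'.ne']
    have h3 := norm_sub_le (f ((C + ‖E.point v‖ + 1) / ‖D‖)) (E.point v)
    simp only [f, add_sub_cancel_left] at h1 h3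
    linarith
  · have : f 0 ∈ closure (f '' Set.Ioi 0) :=
      image_closure_subset_closure_image hf ⟨0, by simp, rfl⟩
    simpa [f] using this

/-! ### The two layers of the drawing -/

namespace TwinExample

open Vert

/-- `X` lists vertices known to be removed. A lower bound on `S` suffices because removing more only
shrinks the drawing. A remaining vertex is tested as the degenerate edge `(w, w)`. -/
theorem mem_outerVertices {S : Set H.vertexSet} (X : List Vert)
    (hX : ∀ x : H.vertexSet, x.1 ∈ X → x ∈ S) {v : H.vertexSet} (hv : v ∉ S) {D : ℤ × ℤ}
    (hD : D ≠ 0) (hd : ∀ w, w ∈ X ∨ RayAvoids v D (w, w))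
    (he : ∀ e ∈ solidPairs ++ dottedPairs, e.1 ∈ X ∨ e.2 ∈ X ∨ RayAvoids v D e) :
    v ∈ planeEmbedding.outerVertices S := by
  refine planeEmbedding.mem_outerVertices_of_ray hv (D := !₂[(D.1 : ℝ), (D.2 : ℝ)]) ?_ ?_
  · intro h
    refine hD (Prod.ext ?_ ?_)
    · simpa using congrArg (fun x : Plane => x 0) h
    · simpa using congrArg (fun x : Plane => x 1) h
  · rintro r hr (⟨w, hw, h⟩ | h)
    · refine ((hd w).resolve_left fun hwX => hw (hX w hwX)).notMem_segment hD hr ?_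
      rw [segment_same]
      exact h.symm
    · simp only [Set.mem_iUnion] at h
      obtain ⟨e, ⟨heG, heS⟩, hx⟩ := h
      obtain ⟨p, hp, rfl⟩ := exists_pair_of_mem_edgeSet heG
      exact (((he p hp).resolve_left fun hX' => heS _ (Sym2.mem_mk_left _ _) (hX _ hX')).resolve_left
        (fun hX' => heS _ (Sym2.mem_mk_right _ _) (hX _ hX'))).notMem_segment hD hr hx

instance : Fintype Vert :=
  ⟨{a, b, c, d, va, vb, vd, ub, uc, ud, t, t'}, fun v => by cases v <;> decide⟩

/-- The direction of a ray from a vertex to infinity. -/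
def rayDirection : Vert → ℤ × ℤ
  | a | t => (-1, 0)
  | c | t' => (1, 0)
  | va | uc => (0, -1)
  | _ => (0, 1)

theorem rayDirection_ne_zero (v : Vert) : rayDirection v ≠ 0 := by
  cases v <;> decide

theorem rayAvoids_first : ∀ v ∈ [a, b, c], (∀ w, RayAvoids v (rayDirection v) (w, w)) ∧
    ∀ e ∈ solidPairs ++ dottedPairs, RayAvoids v (rayDirection v) e := by
  decide +kernel

theorem rayAvoids_second : ∀ v, v ∈ [a, b, c] ∨
    (∀ w, w ∈ [a, b, c] ∨ RayAvoids v (rayDirection v) (w, w)) ∧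
    ∀ e ∈ solidPairs ++ dottedPairs, e.1 ∈ [a, b, c] ∨ e.2 ∈ [a, b, c] ∨
      RayAvoids v (rayDirection v) e := by
  decide +kernel

theorem removed_two_eq_univ : planeEmbedding.removed 2 = Set.univ := by
  have h1 : ∀ v : H.vertexSet, v.1 ∈ [a, b, c] → v ∈ planeEmbedding.removed 1 := fun v hv =>
    .inr (mem_outerVertices [] (by simp) (by simp [PlaneEmbedding.removed]) (rayDirection_ne_zero v)
      (fun w => .inr ((rayAvoids_first v hv).1 w))
      fun e he => .inr (.inr ((rayAvoids_first v hv).2 e he)))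
  refine Set.eq_univ_of_forall fun v => ?_
  by_cases hv : v ∈ planeEmbedding.removed 1
  · exact .inl hv
  · obtain ⟨hd, he⟩ := (rayAvoids_second v).resolve_left fun h => hv (h1 v h)
    exact .inr (mem_outerVertices [a, b, c] h1 hv (rayDirection_ne_zero v) hd he)

end TwinExample

/-! ### Monotonicity in `r` and conclusion -/

theorem PlaneEmbedding.removed_mono {V : Type*} {G : SimpleGraph V} (E : PlaneEmbedding G) :
    Monotone E.removed :=
  monotone_nat_of_le_succ fun _ => Set.subset_union_left

theorem SimpleGraph.IsROuterplanar.mono {V : Type*} {G : SimpleGraph V} {r s : ℕ}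
    (h : G.IsROuterplanar r) (hrs : r ≤ s) : G.IsROuterplanar s := by
  obtain ⟨E, hE⟩ := h
  exact ⟨E, Set.eq_univ_of_univ_subset (hE ▸ E.removed_mono hrs)⟩

theorem Hypergraph.HasROuterplanarSupport.hasPlanarSupport {α : Type*} {H : Hypergraph α} {r : ℕ}
    (h : H.HasROuterplanarSupport r) : H.HasPlanarSupport := by
  obtain ⟨G, hG, E, -⟩ := h
  exact ⟨G, hG, ⟨E⟩⟩

theorem mainTheorem6 :
    TwinExample.H.vertexSet.ncard = 12 ∧
    TwinExample.Vert.t ≠ TwinExample.Vert.t' ∧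
    TwinExample.H.AreTwins TwinExample.Vert.t TwinExample.Vert.t' ∧
    TwinExample.H.IsSupport TwinExample.drawnGraph ∧
    TwinExample.drawnGraph.IsROuterplanar 2 ∧
    TwinExample.H.HasROuterplanarSupport 2 ∧
    ¬ (TwinExample.H.removeVertices {TwinExample.Vert.t}).HasPlanarSupport ∧
    ¬ (TwinExample.H.removeVertices {TwinExample.Vert.t'}).HasPlanarSupport ∧
    (∀ r : ℕ, 2 ≤ r → TwinExample.H.IsYesInstance r ∧
      (TwinExample.H.removeVertices {TwinExample.Vert.t}).IsNoInstance r ∧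
      (TwinExample.H.removeVertices {TwinExample.Vert.t'}).IsNoInstance r) := by
  have hout : TwinExample.drawnGraph.IsROuterplanar 2 := ⟨_, TwinExample.removed_two_eq_univ⟩
  have hsupp := TwinExample.isSupport_drawnGraph
  have ht := TwinExample.not_hasPlanarSupport_removeVertices (.inr ⟨rfl, rfl⟩)
  have ht' := TwinExample.not_hasPlanarSupport_removeVertices (.inl ⟨rfl, rfl⟩)
  refine ⟨?_, by decide, TwinExample.areTwins, hsupp, hout, ⟨_, hsupp, hout⟩, ht, ht',
    fun r hr => ⟨⟨TwinExample.isConnected_H, _, hsupp, hout.mono hr⟩,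
      ⟨TwinExample.isConnected_removeVertices (.inl rfl), fun h => ht h.hasPlanarSupport⟩,
      ⟨TwinExample.isConnected_removeVertices (.inr rfl), fun h => ht' h.hasPlanarSupport⟩⟩⟩
  change (Set.univ : Set TwinExample.Vert).ncard = 12
  rw [Set.ncard_univ, Nat.card_eq_fintype_card]
  rfl
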